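/- Let $M$ and $N$ be von Neumann algebras and let $S:M\to N$ be a normal (that is, weak$^*$-to-weak$^*$ continuous) linear map that is a TRO anti-homomorphism: $S(ab^*c)=S(c)S(b)^*S(a)$ for all $a,b,c\in M$. For a linear map $T:A\to B$ between C$^*$-algebras and a positive integer $n$, let $T_n:M_n(A)\to M_n(B)$, $T_n((a_{ij}))=(T(a_{ij}))$, be its $n$-th amplification, and let $\|T_n\|$ be its operator norm with respect to the C$^*$-norms of $M_n(A)$ and $M_n(B)$. (1) Suppose that $M$ is not abelian and that $S$ is not a TRO homomorphism, i.e. that $S(ab^*c)=S(a)S(b)^*S(c)$ fails for some $a,b,c\in M$ (this holds, for example, whenever $M$ is not abelian and $S$ is injective). Then $\|S_n\|\ge 2$ for every $n\ge 2$. (2) Let $m$ be a positive integer and suppose that $M$ contains a copy of $M_m(\mathbb C)$, i.e. the image of an injective, not necessarily unital, $^*$-homomorphism $M_m(\mathbb C)\to M$, on which $S$ does not vanish identically. Then $\|S_n\|\ge\|\theta(m)_n\|$ for every positive integer $n$, where $\theta(m):M_m(\mathbb C)\to M_m(\mathbb C)$ is the transpose map. -/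

import Mathlib

open scoped ComplexOrder InnerProductSpace ENNReal

/-! ### A von Neumann algebra is a C⋆-algebra, with the order inherited from `H →L[ℂ] H` -/

namespace VonNeumannAlgebra

variable {H : Type*} [NormedAddCommGroup H] [InnerProductSpace ℂ H] [CompleteSpace H]

instance instSMulMemClass : SMulMemClass (VonNeumannAlgebra H) ℂ (H →L[ℂ] H) where
  smul_mem {s} r _ hx := s.toStarSubalgebra.smul_mem hx r

theorem isClosed_coe (M : VonNeumannAlgebra H) : IsClosed (M : Set (H →L[ℂ] H)) := by
  rw [← M.centralizer_centralizer]
  exact Set.isClosed_centralizer _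

noncomputable instance instCStarAlgebra (M : VonNeumannAlgebra H) : CStarAlgebra M :=
  StarSubalgebra.cstarAlgebra M (h_closed := M.isClosed_coe)

instance instStarOrderedRing (M : VonNeumannAlgebra H) : StarOrderedRing M := by
  refine StarOrderedRing.of_nonneg_iff' (fun {x y} h z => ?_) (fun x => ⟨fun hx => ?_, ?_⟩)
  · have h' : (x : H →L[ℂ] H) ≤ y := h
    change (z : H →L[ℂ] H) + x ≤ z + y
    gcongr
  · have hx' : (0 : H →L[ℂ] H) ≤ x := hx
    have hmem : CFC.sqrt (x : H →L[ℂ] H) ∈ M := by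
      rw [← SetLike.mem_coe, ← M.centralizer_centralizer]
      intro y hy
      exact (Commute.cfcₙ_nnreal (show Commute (x : H →L[ℂ] H) y from hy x x.2)
        NNReal.sqrt).symm.eq
    refine ⟨⟨CFC.sqrt (x : H →L[ℂ] H), hmem⟩, Subtype.ext ?_⟩
    change (x : H →L[ℂ] H) = star (CFC.sqrt (x : H →L[ℂ] H)) * CFC.sqrt (x : H →L[ℂ] H)
    rw [(CFC.sqrt_nonneg (x : H →L[ℂ] H)).isSelfAdjoint.star_eq, CFC.sqrt_mul_sqrt_self _ hx']
  · rintro ⟨s, rfl⟩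
    exact star_mul_self_nonneg (s : H →L[ℂ] H)

/-- The weak⋆ (ultraweak, or σ-weak) topology of a von Neumann algebra `M` on `H`: the coarsest
topology making all the functionals `x ↦ ∑ᵢ ⟪ξᵢ, x ηᵢ⟫` continuous, where `(ξᵢ)` and `(ηᵢ)` are
square-summable sequences of vectors of `H`. -/
@[reducible]
noncomputable def ultraweakTopology (M : VonNeumannAlgebra H) : TopologicalSpace M :=
  ⨅ (ξ : lp (fun _ : ℕ => H) 2) (η : lp (fun _ : ℕ => H) 2),
    TopologicalSpace.induced (fun x : M => ∑' i, ⟪ξ i, (x : H →L[ℂ] H) (η i)⟫_ℂ) inferInstance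

end VonNeumannAlgebra

/-- A linear map between von Neumann algebras is normal if it is weak⋆-to-weak⋆ continuous. -/
def IsNormalMap {H K : Type*} [NormedAddCommGroup H] [InnerProductSpace ℂ H] [CompleteSpace H]
    [NormedAddCommGroup K] [InnerProductSpace ℂ K] [CompleteSpace K]
    {M : VonNeumannAlgebra H} {N : VonNeumannAlgebra K} (S : M →ₗ[ℂ] N) : Prop :=
  @Continuous M N M.ultraweakTopology N.ultraweakTopology S

/-- `T` is a TRO homomorphism: `T [a,b,c] = [T a, T b, T c]`, where `[a,b,c] = a b⋆ c`. -/
def IsTROHom {A B : Type*} [CStarAlgebra A] [CStarAlgebra B] (T : A →ₗ[ℂ] B) : Prop :=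
  ∀ a b c : A, T (a * star b * c) = T a * star (T b) * T c

/-- `T` is a TRO anti-homomorphism: `T [a,b,c] = [T c, T b, T a]`, where `[a,b,c] = a b⋆ c`. -/
def IsTROAntiHom {A B : Type*} [CStarAlgebra A] [CStarAlgebra B] (T : A →ₗ[ℂ] B) : Prop :=
  ∀ a b c : A, T (a * star b * c) = T c * star (T b) * T a

/-- The operator norm `sup {‖T x‖ : ‖x‖ ≤ 1}` of a linear map, with values in `[0, ∞]`. -/
noncomputable def opENorm {E F : Type*} [NormedAddCommGroup E] [NormedSpace ℂ E]
    [NormedAddCommGroup F] [NormedSpace ℂ F] (T : E →ₗ[ℂ] F) : ℝ≥0∞ :=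
  ⨆ x : {x : E // ‖x‖ ≤ 1}, ‖T x‖ₑ

/-- The `n`-th amplification `T_n : M_n(A) → M_n(B)`, `T_n (a_ij) = (T a_ij)`. Here
`CStarMatrix (Fin n) (Fin n) A` is `M_n(A)` with its C⋆-norm. -/
noncomputable def amplification (n : ℕ) {A B : Type*} [CStarAlgebra A] [CStarAlgebra B] (T : A →ₗ[ℂ] B) :
    CStarMatrix (Fin n) (Fin n) A →ₗ[ℂ] CStarMatrix (Fin n) (Fin n) B :=
  CStarMatrix.mapₗ T

/-- The transpose map `θ(m)` on the C⋆-algebra `M_m(ℂ)`. -/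
noncomputable def transposeMap (m : ℕ) :
    CStarMatrix (Fin m) (Fin m) ℂ →ₗ[ℂ] CStarMatrix (Fin m) (Fin m) ℂ where
  toFun x := x.transpose
  map_add' _ _ := rfl
  map_smul' _ _ := rfl

/-!
Let `v = S(1)`. The anti-homomorphism identity shows that `v` is a partial isometry, that
`φ(a) = v⋆ S(a)` is a ⋆-anti-homomorphism and that `S(a) = v φ(a)`
(`IsTROAntiHom.compress_mul`, `IsTROAntiHom.compress_star`,
`IsTROAntiHom.map_one_mul_compress`). Since `φ_n(X)` is `S_n(X)` multiplied by a contraction, lower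
bounds for `‖φ_n‖` are lower bounds for `‖S_n‖` (`IsTROAntiHom.norm_mapₗ_compress_le`).

For a copy `ι` of `M_m(ℂ)`, the map `π = φ ∘ ι ∘ θ(m)` is a nonzero ⋆-homomorphism on a simple
algebra, hence injective, hence `π_n` is isometric. As `φ_n ∘ ι_n = π_n ∘ θ(m)_n` and `ι_n` is a
contraction, `‖θ(m)_n‖ ≤ ‖φ_n‖`.

If `S` is not a TRO homomorphism then the range of `φ` is not commutative
(`IsTROAntiHom.isTROHom_of_commute`). In that case there is `a` with `a² = 0` and `φ(a) ≠ 0`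
(`commute_map_of_map_eq_zero_of_sq`). The functional calculus of `a⋆ a` turns `a` into some `c`
with `c² = 0`, `‖c‖ ≤ 1` and `‖φ(c)‖ ≥ 1` (`exists_sq_eq_zero_one_le_norm_map`). Such a `c`
behaves like a matrix unit `e₁₂`: with `a = c (c⋆ c)^(1/2)`, the matrix with rows `(c c⋆, a⋆)` and
`(a, c⋆ c)` plays the role of the flip `∑ E_ij ⊗ e_ji`, which has norm `1`, and its image under
`φ₂` that of `∑ E_ij ⊗ e_ij`, which has norm `2` (`exists_norm_le_one_two_le_norm_mapₗ`).

The existence of the square-zero element is proved by contradiction. Suppose that the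
⋆-homomorphism `ψ` kills every square-zero element. For `h` self-adjoint and `l` real, let `r` and
`s` be the positive and negative parts of `h - l`. Then `r x s` and `s x r` are square-zero, whence
`ψ(|h - l| x (h - l)) = ψ((h - l) x |h - l|)`. Integrated over `l`, this identity
becomes the vanishing of the triple commutator of `ψ(h)` with `ψ(x)`. For a self-adjoint element this
forces the simple commutator to vanish.
-/

/-! ### Iterated commutators with a self-adjoint element -/

section CommutatorVanishing

variable {B : Type*} [CStarAlgebra B]

/-- If `D = [k, z]` commutes with the self-adjoint element `k`, then `s ↦ e^{isk} z e^{-isk}` is the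
affine function `z + s i D`; being bounded, it is constant, so `D = 0`. -/
theorem IsSelfAdjoint.commute_of_commute_commutator {k : B} (hk : IsSelfAdjoint k) {z : B}
    (h : Commute k (k * z - z * k)) : Commute k z := by
  set D := k * z - z * k with hD
  let +nondep : NormedAlgebra ℚ B := .restrictScalars ℚ ℂ B
  let a : B := Complex.I • k
  have ha : star a = -a := by simp [a, hk.star_eq]
  let e : ℝ → B := fun s => NormedSpace.exp (s • a)
  have he (s : ℝ) : e s ∈ unitary B := by
    refine NormedSpace.exp_mem_unitary_of_mem_skewAdjoint ?_
    rw [skewAdjoint.mem_iff]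
    simp [ha]
  have hd (s : ℝ) : HasDerivAt e (e s * a) s := hasDerivAt_exp_smul_const a s
  have hd' (s : ℝ) : HasDerivAt (fun s => e (-s)) (-(a * e (-s))) s := by
    simpa [Function.comp_def, e] using (hasDerivAt_exp_smul_const' a (-s)).scomp s (hasDerivAt_neg s)
  have hcomm (s : ℝ) : Commute (e s) D :=
    ((h.smul_left Complex.I).smul_left s).exp_left
  have hinv (s : ℝ) : e s * e (-s) = 1 := by
    simp only [e, neg_smul]
    rw [← NormedSpace.exp_add_of_commute (Commute.neg_right (Commute.refl _))]
    simp
  let g : ℝ → B := fun s => e s * z * e (-s) - s • (Complex.I • D)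
  have hg (s : ℝ) : HasDerivAt g 0 s := by
    have h1 := (((hd s).mul_const z).mul (hd' s)).sub
      ((hasDerivAt_id s).smul_const (Complex.I • D))
    refine h1.congr_deriv ?_ |>.congr_of_eventuallyEq (.of_forall fun _ => rfl)
    have : e s * a * z * e (-s) + e s * z * (-(a * e (-s))) = e s * (a * z - z * a) * e (-s) := by
      noncomm_ring
    rw [this]
    have : a * z - z * a = Complex.I • D := by simp [a, hD, smul_sub]
    rw [this, mul_smul_comm, smul_mul_assoc, (hcomm s).eq, mul_assoc, hinv]
    simp
  have hconst (s : ℝ) : e s * z * e (-s) = z + s • (Complex.I • D) := by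
    have h2 : g s = g 0 := is_const_of_deriv_eq_zero (fun s => (hg s).differentiableAt)
      (fun s => (hg s).deriv) s 0
    simp only [g, e, zero_smul, neg_zero, NormedSpace.exp_zero] at h2
    rw [sub_zero, one_mul, mul_one, sub_eq_iff_eq_add] at h2
    exact h2
  have hbound (s : ℝ) (hs : 0 < s) : s * ‖D‖ ≤ 2 * ‖z‖ := by
    have h3 : ‖z + s • (Complex.I • D)‖ = ‖z‖ := by
      rw [← hconst, CStarRing.norm_mul_mem_unitary _ (he (-s)),
        CStarRing.norm_mem_unitary_mul _ (he s)]
    have h4 : ‖s • (Complex.I • D)‖ = s * ‖D‖ := by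
      simp [norm_smul, abs_of_pos hs]
    rw [← h4]
    calc ‖s • (Complex.I • D)‖ = ‖(z + s • (Complex.I • D)) - z‖ := by simp
      _ ≤ ‖z‖ + ‖z‖ := (norm_sub_le _ _).trans_eq (by rw [h3])
      _ = 2 * ‖z‖ := by ring
  have hD0 : D = 0 := by
    by_contra hne
    have hpos : 0 < ‖D‖ := norm_pos_iff.mpr hne
    have h5 := hbound ((2 * ‖z‖ + 1) / ‖D‖) (by positivity)
    rw [div_mul_cancel₀ _ hpos.ne'] at h5
    linarith
  exact sub_eq_zero.mp hD0

/-- The hypothesis is the expanded form of `[k, [k, [k, y]]] = 0`. -/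
theorem IsSelfAdjoint.commute_of_triple_commutator_eq_zero {k y : B} (hk : IsSelfAdjoint k)
    (h : k ^ 3 * y - 3 • (k ^ 2 * y * k) + 3 • (k * y * k ^ 2) - y * k ^ 3 = 0) :
    Commute k y := by
  refine hk.commute_of_commute_commutator (hk.commute_of_commute_commutator ?_)
  refine sub_eq_zero.mp (Eq.trans ?_ h)
  noncomm_ring

end CommutatorVanishing

/-! ### Square-zero elements and commutativity -/

section SquareZero

variable {A B : Type*} [CStarAlgebra A] [CStarAlgebra B]

open MeasureTheory

theorem intervalIntegral_abs_sub {t R : ℝ} (h : |t| ≤ R) :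
    ∫ l in (-R)..R, |t - l| = t ^ 2 + R ^ 2 := by
  obtain ⟨h1, h2⟩ := abs_le.mp h
  rw [← intervalIntegral.integral_add_adjacent_intervals (b := t)
    (Continuous.intervalIntegrable (by fun_prop) _ _)
    (Continuous.intervalIntegrable (by fun_prop) _ _),
    intervalIntegral.integral_congr (a := -R) (b := t) (g := fun l => t - l),
    intervalIntegral.integral_congr (a := t) (b := R) (g := fun l => l - t)]
  · rw [intervalIntegral.integral_comp_sub_left (fun l => l)]
    simp
    ring
  · intro l hl
    rw [Set.uIcc_of_le h2] at hl
    exact (abs_sub_comm t l).trans (abs_of_nonneg (sub_nonneg.mpr hl.1))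
  · intro l hl
    rw [Set.uIcc_of_le h1] at hl
    exact abs_of_nonneg (sub_nonneg.mpr hl.2)

theorem intervalIntegral_mul_abs_sub {t R : ℝ} (h : |t| ≤ R) :
    ∫ l in (-R)..R, l * |t - l| = t ^ 3 / 3 - R ^ 2 * t := by
  obtain ⟨h1, h2⟩ := abs_le.mp h
  rw [← intervalIntegral.integral_add_adjacent_intervals (b := t)
    (Continuous.intervalIntegrable (by fun_prop) _ _)
    (Continuous.intervalIntegrable (by fun_prop) _ _),
    intervalIntegral.integral_congr (a := -R) (b := t) (g := fun l => t * l - l ^ 2),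
    intervalIntegral.integral_congr (a := t) (b := R) (g := fun l => l ^ 2 - t * l)]
  · rw [intervalIntegral.integral_sub (Continuous.intervalIntegrable (by fun_prop) _ _)
      (Continuous.intervalIntegrable (by fun_prop) _ _),
      intervalIntegral.integral_sub (Continuous.intervalIntegrable (by fun_prop) _ _)
      (Continuous.intervalIntegrable (by fun_prop) _ _)]
    have hlin (a b : ℝ) : ∫ l in a..b, t * l = t * ((b ^ 2 - a ^ 2) / 2) := by
      rw [intervalIntegral.integral_const_mul, integral_id]
    rw [hlin, hlin]
    simp only [integral_pow]
    push_cast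
    ring
  · intro l hl
    rw [Set.uIcc_of_le h2] at hl
    simp only [abs_sub_comm t l, abs_of_nonneg (sub_nonneg.mpr hl.1)]
    ring
  · intro l hl
    rw [Set.uIcc_of_le h1] at hl
    simp only [abs_of_nonneg (sub_nonneg.mpr hl.2)]
    ring

theorem IsSelfAdjoint.setIntegral_cfc {h : A} (hh : IsSelfAdjoint h) {f : ℝ → ℝ → ℝ}
    (hf : Continuous (Function.uncurry f)) (a b : ℝ) :
    IntegrableOn (fun l => cfc (f l) h) (Set.Ioc a b) ∧
      ∫ l in Set.Ioc a b, cfc (f l) h = cfc (fun t => ∫ l in Set.Ioc a b, f l t) h := by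
  obtain ⟨C, hC⟩ := (isCompact_Icc (a := a) (b := b)).prod
    (spectrum.isCompact (𝕜 := ℝ) h) |>.exists_bound_of_continuousOn hf.continuousOn
  have hb : ∀ᵐ l ∂(volume.restrict (Set.Ioc a b)), ∀ t ∈ spectrum ℝ h, ‖f l t‖ ≤ C :=
    ae_restrict_of_forall_mem measurableSet_Ioc fun l hl t ht =>
      hC (l, t) ⟨Set.Ioc_subset_Icc_self hl, ht⟩
  have hi : HasFiniteIntegral (fun _ : ℝ => C) (volume.restrict (Set.Ioc a b)) :=
    (integrable_const C).2
  exact ⟨integrableOn_cfc measurableSet_Ioc f _ h hf.continuousOn hb hi hh,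
    (cfc_setIntegral measurableSet_Ioc f _ h hf.continuousOn hb hi hh).symm⟩

theorem IsSelfAdjoint.norm_le_of_mem_spectrum {h : A} (hh : IsSelfAdjoint h) {t : ℝ}
    (ht : t ∈ spectrum ℝ h) : |t| ≤ ‖h‖ := by
  simpa [cfc_id ℝ h] using norm_apply_le_norm_cfc (id : ℝ → ℝ) h ht

theorem IsSelfAdjoint.setIntegral_cfc_abs_sub {h : A} (hh : IsSelfAdjoint h) :
    ∫ l in Set.Ioc (-‖h‖) ‖h‖, cfc (fun t => |t - l|) h = h ^ 2 + algebraMap ℝ A (‖h‖ ^ 2) := by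
  rw [(hh.setIntegral_cfc (f := fun l t => |t - l|) (by fun_prop) _ _).2]
  rw [cfc_congr (g := fun t => t ^ 2 + ‖h‖ ^ 2) fun t ht => ?_,
    cfc_add_const _ _ h, cfc_pow_id h 2]
  simp only
  rw [← intervalIntegral.integral_of_le (by linarith [norm_nonneg h])]
  exact intervalIntegral_abs_sub (hh.norm_le_of_mem_spectrum ht)

theorem IsSelfAdjoint.setIntegral_cfc_mul_abs_sub {h : A} (hh : IsSelfAdjoint h) :
    ∫ l in Set.Ioc (-‖h‖) ‖h‖, cfc (fun t => l * |t - l|) h =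
      (3⁻¹ : ℝ) • h ^ 3 - (‖h‖ ^ 2) • h := by
  rw [(hh.setIntegral_cfc (f := fun l t => l * |t - l|) (by fun_prop) _ _).2]
  rw [cfc_congr (g := fun t => (3⁻¹ : ℝ) • t ^ 3 - (‖h‖ ^ 2) • t) fun t ht => ?_,
    cfc_sub _ _ h, cfc_smul _ _ h, cfc_smul _ _ h, cfc_pow_id h 3, cfc_id' ℝ h]
  simp only [smul_eq_mul]
  rw [← intervalIntegral.integral_of_le (by linarith [norm_nonneg h]),
    intervalIntegral_mul_abs_sub (hh.norm_le_of_mem_spectrum ht)]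
  ring

variable (ψ : A →⋆ₙₐ[ℂ] B)

/-- With `r` and `s` the positive and negative parts of `h - l`, both sides equal
`ψ(r x r - s x s)`, because the mixed terms `r x s` and `s x r` square to zero. -/
theorem map_cfc_abs_sub_mul_eq (hψ : ∀ a : A, a * a = 0 → ψ a = 0) {h : A}
    (hh : IsSelfAdjoint h) (x : A) (l : ℝ) :
    ψ (cfc (fun t => |t - l|) h * x * (h - algebraMap ℝ A l)) =
      ψ ((h - algebraMap ℝ A l) * x * cfc (fun t => |t - l|) h) := by
  set r := cfc (fun t => max (t - l) 0) h with hr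
  set s := cfc (fun t => max (l - t) 0) h with hs
  have hrs : r * s = 0 := by
    rw [hr, hs, ← cfc_mul _ _ h, ← cfc_zero ℝ h]
    refine cfc_congr fun t _ => ?_
    rcases le_total t l with h | h <;> simp [h]
  have hsr : s * r = 0 := by rw [← hrs]; exact cfc_commute_cfc _ _ h
  have h1 : cfc (fun t => |t - l|) h = r + s := by
    rw [hr, hs, ← cfc_add h _ _]
    refine cfc_congr fun t _ => ?_
    rcases le_total t l with h | h
    · simp [h, abs_of_nonpos]
    · simp [h, abs_of_nonneg]
  have h2 : h - algebraMap ℝ A l = r - s := by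
    rw [hr, hs, ← cfc_sub _ _ h]
    nth_rw 1 [← cfc_id' ℝ h]
    rw [← cfc_const l h, ← cfc_sub _ _ h]
    refine cfc_congr fun t _ => ?_
    rcases le_total t l with h | h <;> simp [h]
  have h3 : ψ (r * x * s) = 0 := hψ _ <| by
    rw [show r * x * s * (r * x * s) = r * x * (s * r) * x * s by noncomm_ring, hsr]; simp
  have h4 : ψ (s * x * r) = 0 := hψ _ <| by
    rw [show s * x * r * (s * x * r) = s * x * (r * s) * x * r by noncomm_ring, hrs]; simp
  rw [h1, h2, show (r + s) * x * (r - s) = r * x * r - s * x * s + (s * x * r - r * x * s) by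
      noncomm_ring, show (r - s) * x * (r + s) = r * x * r - s * x * s + (r * x * s - s * x * r) by
      noncomm_ring, map_add ψ, map_add ψ, map_sub ψ (s * x * r), map_sub ψ (r * x * s), h3, h4]

/-- A ⋆-homomorphism that kills all elements of square zero has commutative range. -/
theorem commute_map_of_map_eq_zero_of_sq (hψ : ∀ a : A, a * a = 0 → ψ a = 0) (x y : A) :
    Commute (ψ x) (ψ y) := by
  suffices H : ∀ h : A, IsSelfAdjoint h → Commute (ψ h) (ψ y) by
    rw [← realPart_add_I_smul_imaginaryPart x, map_add, map_smul]
    exact (H _ (realPart x).2).add_left ((H _ (imaginaryPart x).2).smul_left _)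
  intro h hh
  refine (hh.map ψ).commute_of_triple_commutator_eq_zero ?_
  have hc : Continuous ψ := AddMonoidHomClass.continuous_of_bound ψ 1 fun a => by
    simpa using NonUnitalStarAlgHom.norm_apply_le ψ a
  let ψL : A →L[ℝ] B :=
    (⟨(ψ : A →ₗ[ℂ] B), hc⟩ : A →L[ℂ] B).restrictScalars ℝ
  let mL (a : A) : A →L[ℝ] A := ContinuousLinearMap.mul ℝ A a
  let mR (a : A) : A →L[ℝ] A := (ContinuousLinearMap.mul ℝ A).flip a
  let Φ₁ : A →L[ℝ] B := ψL ∘L (mR (y * h) - mL (h * y))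
  let Φ₂ : A →L[ℝ] B := ψL ∘L (mR y - mL y)
  have hΦ₁ (u : A) : Φ₁ u = ψ (u * (y * h) - h * y * u) := rfl
  have hΦ₂ (u : A) : Φ₂ u = ψ (u * y - y * u) := rfl
  -- The identity `map_cfc_abs_sub_mul_eq`, sorted by powers of `l`: both sides are continuous
  -- linear images of functions of `h`, so that they can be integrated over `l`.
  have key (l : ℝ) : Φ₁ (cfc (fun t => |t - l|) h) = Φ₂ (cfc (fun t => l * |t - l|) h) := by
    have h1 := sub_eq_zero.mpr (map_cfc_abs_sub_mul_eq ψ hψ hh y l)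
    rw [cfc_const_mul l _ h, hΦ₁, hΦ₂, ← sub_eq_zero, ← map_sub]
    rw [← map_sub] at h1
    convert h1 using 2
    simp only [Algebra.algebraMap_eq_smul_one, mul_sub, sub_mul, smul_mul_assoc, mul_smul_comm,
      mul_one, one_mul, mul_assoc]
    abel
  -- On the spectrum of `h`, the integrals over `[-‖h‖, ‖h‖]` of `|t - l|` and `l |t - l|` are
  -- `t² + ‖h‖²` and `t³ / 3 - ‖h‖² t`; the terms in `‖h‖²` cancel below.
  have hint : Φ₁ (h ^ 2 + algebraMap ℝ A (‖h‖ ^ 2)) =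
      Φ₂ ((3⁻¹ : ℝ) • h ^ 3 - (‖h‖ ^ 2) • h) := by
    rw [← hh.setIntegral_cfc_abs_sub, ← hh.setIntegral_cfc_mul_abs_sub,
      ← ContinuousLinearMap.integral_comp_comm _
        (hh.setIntegral_cfc (f := fun l t => |t - l|) (by fun_prop) _ _).1,
      ← ContinuousLinearMap.integral_comp_comm _
        (hh.setIntegral_cfc (f := fun l t => l * |t - l|) (by fun_prop) _ _).1]
    simp only [key]
  have h0 := sub_eq_zero.mpr hint
  rw [hΦ₁, hΦ₂, ← map_sub] at h0
  have h5 : h ^ 3 * y - 3 • (h ^ 2 * y * h) + 3 • (h * y * h ^ 2) - y * h ^ 3 =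
      (-3 : ℂ) • ((h ^ 2 + algebraMap ℝ A (‖h‖ ^ 2)) * (y * h) -
        h * y * (h ^ 2 + algebraMap ℝ A (‖h‖ ^ 2)) -
        (((3⁻¹ : ℝ) • h ^ 3 - (‖h‖ ^ 2) • h) * y - y * ((3⁻¹ : ℝ) • h ^ 3 - (‖h‖ ^ 2) • h))) := by
    simp only [Algebra.algebraMap_eq_smul_one, mul_sub, sub_mul, mul_add, add_mul, smul_mul_assoc,
      mul_smul_comm, mul_one, one_mul, mul_assoc, ← Complex.coe_smul]
    push_cast
    module
  have h6 : ψ (h ^ 3 * y - 3 • (h ^ 2 * y * h) + 3 • (h * y * h ^ 2) - y * h ^ 3) = 0 := by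
    rw [h5, map_smul, h0, smul_zero]
  have hpow2 : ψ (h ^ 2) = ψ h ^ 2 := by rw [pow_two, pow_two, map_mul]
  have hpow3 : ψ (h ^ 3) = ψ h ^ 3 := by rw [pow_succ, pow_succ (ψ h), map_mul, hpow2]
  rw [← h6]
  simp only [map_add, map_sub, map_nsmul, map_mul, hpow2, hpow3]

end SquareZero

/-! ### Normalizing a square-zero element -/

section Truncation

variable {A B : Type*} [CStarAlgebra A] [CStarAlgebra B]

theorem quasispectrum_star_mul_self_nonneg {a : B} {t : ℝ}
    (ht : t ∈ quasispectrum ℝ (star a * a)) : 0 ≤ t := by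
  rw [quasispectrum_eq_spectrum_union_zero] at ht
  rcases ht with ht | rfl
  · exact spectrum_star_mul_self_nonneg t ht
  · exact le_rfl

theorem norm_sq_mem_quasispectrum_star_mul_self (a : B) :
    ‖a‖ ^ 2 ∈ quasispectrum ℝ (star a * a) := by
  obtain ⟨t, ht, hta⟩ :=
    (NonUnitalIsometricContinuousFunctionalCalculus.isGreatest_norm_quasispectrum
      (𝕜 := ℝ) (star a * a) (IsSelfAdjoint.star_mul_self a)).1
  rw [CStarRing.norm_star_mul_self, ← pow_two] at hta
  rw [← hta]
  simpa [abs_of_nonneg (quasispectrum_star_mul_self_nonneg ht)] using ht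

/-- With `b = a⋆ a` and `s = ‖ψ(a)‖`, the element `c = a k(b) b` satisfies `c⋆ c = f(b)` for
`f(t) = t³ k(t)²`, and `k` is chosen such that `0 ≤ f ≤ 1` on `[0, ∞)` with `f(s²) = 1`, where `s²`
lies in the spectrum of `ψ(b)`. The factor `b` makes `c` square to zero, since `b a = 0`. -/
theorem exists_sq_eq_zero_one_le_norm_map (ψ : A →⋆ₙₐ[ℂ] B) {a : A} (ha : a * a = 0)
    (hψa : ψ a ≠ 0) : ∃ c : A, c * c = 0 ∧ ‖c‖ ≤ 1 ∧ 1 ≤ ‖ψ c‖ := by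
  set b := star a * a with hb
  have hbsa : IsSelfAdjoint b := .star_mul_self a
  set s := ‖ψ a‖ with hs
  have hspos : 0 < s := norm_pos_iff.mpr hψa
  let k : ℝ → ℝ := fun t => 8 * s ^ 3 / (t + s ^ 2) ^ 3
  let f : ℝ → ℝ := fun t => (4 * t * s ^ 2 / (t + s ^ 2) ^ 2) ^ 3
  have hq (t : ℝ) (ht : t ∈ quasispectrum ℝ b) : 0 < t + s ^ 2 :=
    add_pos_of_nonneg_of_pos (quasispectrum_star_mul_self_nonneg ht) (by positivity)
  have hσ : spectrum ℝ b ⊆ quasispectrum ℝ b := spectrum_subset_quasispectrum ℝ b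
  have hk : ContinuousOn k (spectrum ℝ b) :=
    ContinuousOn.div (by fun_prop) (by fun_prop) fun t ht => (pow_pos (hq t (hσ ht)) 3).ne'
  have hf : ContinuousOn f (quasispectrum ℝ b) :=
    (ContinuousOn.div (by fun_prop) (by fun_prop) fun t ht => (pow_pos (hq t ht) 2).ne').pow 3
  have hf0 : f 0 = 0 := by simp [f]
  set u := cfc k b with hu
  have husa : IsSelfAdjoint u := cfc_predicate k b
  have hcc : star (a * (u * b)) * (a * (u * b)) = cfcₙ f b := by
    rw [cfcₙ_eq_cfc hf hf0]
    have h1 : star (a * (u * b)) * (a * (u * b)) = b * u * b * (u * b) := by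
      rw [star_mul, star_mul, husa.star_eq, hbsa.star_eq, mul_assoc (b * u), ← mul_assoc (star a),
        ← hb, ← mul_assoc (b * u)]
    have h2 : cfc f b = cfc (fun t => t * k t * t * (k t * t)) b := by
      refine cfc_congr fun t ht => ?_
      have := hq t (hσ ht)
      simp only [f, k]
      field_simp
      ring
    rw [h1, h2, cfc_mul (fun t => t * k t * t) (fun t => k t * t) b,
      cfc_mul (fun t => t * k t) (fun t => t) b, cfc_mul (fun t => t) k b, cfc_mul k (fun t => t) b,
      cfc_id' ℝ b]
  refine ⟨a * (u * b), ?_, ?_, ?_⟩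
  · have : b * a = 0 := by rw [hb, mul_assoc, ha, mul_zero]
    rw [show a * (u * b) * (a * (u * b)) = a * u * (b * a) * (u * b) by noncomm_ring, this]
    simp
  · rw [← sq_le_one_iff₀ (norm_nonneg _), pow_two, ← CStarRing.norm_star_mul_self, hcc]
    refine norm_cfcₙ_le fun t ht => ?_
    have h0 : 0 ≤ t := quasispectrum_star_mul_self_nonneg ht
    have h1 := hq t ht
    rw [Real.norm_of_nonneg (by positivity)]
    refine pow_le_one₀ (by positivity) ?_
    rw [div_le_one (by positivity)]
    -- AM-GM: `4 t s² ≤ (t + s²)²`.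
    nlinarith [sq_nonneg (t - s ^ 2)]
  · have hc : Continuous ψ := AddMonoidHomClass.continuous_of_bound ψ 1 fun a => by
      simpa using NonUnitalStarAlgHom.norm_apply_le ψ a
    have hψb : ψ b = star (ψ a) * ψ a := by rw [hb, map_mul, map_star]
    have hmem : s ^ 2 ∈ quasispectrum ℝ (ψ b) := by
      rw [hψb]; exact norm_sq_mem_quasispectrum_star_mul_self (ψ a)
    have hfψ : ContinuousOn f (quasispectrum ℝ (ψ b)) := by
      refine (ContinuousOn.div (by fun_prop) (by fun_prop) fun t ht => ?_).pow 3
      rw [hψb] at ht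
      exact (pow_pos (add_pos_of_nonneg_of_pos (quasispectrum_star_mul_self_nonneg ht)
        (by positivity)) 2).ne'
    rw [← one_le_sq_iff₀ (norm_nonneg _), pow_two, ← CStarRing.norm_star_mul_self, ← map_star,
      ← map_mul, hcc, ψ.map_cfcₙ f b hf hf0 hc hbsa (hbsa.map ψ)]
    have h2 : f (s ^ 2) = 1 := by
      simp only [f]
      field_simp
      norm_num
    calc (1 : ℝ) = ‖f (s ^ 2)‖ := by simp [h2]
      _ ≤ _ := norm_apply_le_norm_cfcₙ f (ψ b) hmem hfψ hf0 (hbsa.map ψ)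

end Truncation

/-! ### A flip-like matrix over an algebra with a square-zero element -/

section Matrix

variable {A B : Type*} [CStarAlgebra A] [PartialOrder A] [StarOrderedRing A]
  [CStarAlgebra B] [PartialOrder B] [StarOrderedRing B]

namespace CStarMatrix

variable {ι : Type*} [DecidableEq ι]

/-- The matrix with a single nonzero entry `a` at the place `(i, j)`. -/
def single {A : Type*} [Zero A] (i j : ι) (a : A) : CStarMatrix ι ι A :=
  ofMatrix (Matrix.single i j a)

theorem single_mul_single_same [Fintype ι] {A : Type*} [NonUnitalNonAssocSemiring A]
    (i j l : ι) (a b : A) :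
    single i j a * single j l b = single i l (a * b) :=
  Matrix.single_mul_single_same a i j l b

theorem single_mul_single_of_ne [Fintype ι] {A : Type*} [NonUnitalNonAssocSemiring A]
    (i : ι) {j k : ι} (l : ι)
    (h : j ≠ k) (a b : A) : single i j a * single k l b = 0 :=
  Matrix.single_mul_single_of_ne a i j k h b

theorem single_add {A : Type*} [AddZeroClass A] (i j : ι) (a b : A) :
    single i j (a + b) = single i j a + single i j b :=
  Matrix.single_add i j a b

theorem star_single {A : Type*} [AddMonoid A] [StarAddMonoid A] (i j : ι) (a : A) :
    star (single i j a) = single j i (star a) :=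
  Matrix.conjTranspose_single i j a

theorem mapₗ_single {A B : Type*} [AddCommMonoid A] [Module ℂ A] [AddCommMonoid B] [Module ℂ B]
    (T : A →ₗ[ℂ] B) (i j : ι) (a : A) : mapₗ T (single i j a) = single i j (T a) :=
  Matrix.map_single i j a T

/-- The corner embedding `a ↦ E_ii ⊗ a` as a ⋆-homomorphism. -/
def singleHom [Fintype ι] (A : Type*) [CStarAlgebra A] (i : ι) : A →⋆ₙₐ[ℂ] CStarMatrix ι ι A where
  toFun := single i i
  map_smul' r a := (Matrix.smul_single r i i a).symm
  map_zero' := Matrix.single_zero i i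
  map_add' := single_add i i
  map_mul' a b := (single_mul_single_same i i i a b).symm
  map_star' a := (star_single i i a).symm

theorem norm_single [Fintype ι] (i : ι) (a : A) : ‖single i i a‖ = ‖a‖ :=
  NonUnitalStarAlgHom.norm_map (singleHom A i) (fun x y h => by
    have h' : Matrix.single i i x i i = Matrix.single i i y i i := congrFun (congrFun h i) i
    simpa using h') a

end CStarMatrix

open CStarMatrix

/-- A ⋆-anti-homomorphism which does not decrease the norm of some square-zero contraction has
amplifications of norm at least `2` on matrices of size at least two. -/
theorem exists_norm_le_one_two_le_norm_mapₗ (φ : A →ₗ[ℂ] B)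
    (hmul : ∀ a b, φ (a * b) = φ b * φ a) (hstar : ∀ a, φ (star a) = star (φ a))
    {c : A} (hc : c * c = 0) (hc1 : ‖c‖ ≤ 1) (hφc : 1 ≤ ‖φ c‖)
    {ι : Type*} [Fintype ι] [DecidableEq ι] {i j : ι} (hij : i ≠ j) :
    ∃ X : CStarMatrix ι ι A, ‖X‖ ≤ 1 ∧ 2 ≤ ‖mapₗ φ X‖ := by
  set q := star c * c with hq
  set p := c * star c with hp
  have hqsa : star q = q := (IsSelfAdjoint.star_mul_self c).star_eq
  have hpsa : star p = p := (IsSelfAdjoint.mul_star_self c).star_eq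
  set w := CFC.sqrt q with hw
  have hww : w * w = q := CFC.sqrt_mul_sqrt_self q (star_mul_self_nonneg c)
  have hwsa : star w = w := (CFC.sqrt_nonneg q).isSelfAdjoint.star_eq
  have hwc : w * c = 0 := by
    rw [← norm_eq_zero, ← sq_eq_zero_iff, pow_two, ← CStarRing.norm_star_mul_self, norm_eq_zero,
      star_mul, hwsa, mul_assoc, ← mul_assoc w, hww, hq, mul_assoc (star c), hc]
    simp
  set a := c * w with ha
  have hpc : p * c = c * q := by rw [hp, hq, mul_assoc]
  have hwq : w * q = q * w := by rw [← hww, mul_assoc]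
  have hpa : p * a = a * q := by rw [ha, ← mul_assoc, hpc, mul_assoc, ← hwq, ← mul_assoc]
  have haa : star a * a = q * q := by
    rw [ha, star_mul, hwsa, mul_assoc, ← mul_assoc (star c), ← hq, ← hwq, ← mul_assoc, hww]
  have haa' : a * star a = p * p := by
    rw [ha, star_mul, hwsa, mul_assoc, ← mul_assoc w, hww, hq, hp]; simp only [mul_assoc]
  have hap : a * p = 0 := by
    rw [ha, hp, ← mul_assoc, mul_assoc c, hwc]; simp
  have hqa : q * a = 0 := by rw [ha, hq, ← mul_assoc, mul_assoc (star c), hc]; simp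
  have hpa' : p * star a = 0 := by simpa [hpsa] using congrArg star hap
  have haq' : star a * q = 0 := by simpa [hqsa] using congrArg star hqa
  have hnq : ‖q‖ ≤ 1 := by
    rw [hq, CStarRing.norm_star_mul_self]; exact mul_le_one₀ hc1 (norm_nonneg _) hc1
  have hnp : ‖p‖ ≤ 1 := by
    rw [hp, CStarRing.norm_self_mul_star]; exact mul_le_one₀ hc1 (norm_nonneg _) hc1
  -- If `c` were `g ⊗ e₁₂`, then `X` would be `∑ E_ij ⊗ g² ⊗ e_ji`.
  let X : CStarMatrix ι ι A := single i i p + single i j (star a) + single j i a + single j j q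
  set d := p * p + q * q with hd
  have hXstar : star X = X := by
    simp only [X, star_add, star_single, star_star, hpsa, hqsa]
    abel
  have hXX : X * X = single i i d + single j j d := by
    simp only [X, mul_add, add_mul, single_mul_single_same, single_mul_single_of_ne _ _ hij,
      single_mul_single_of_ne _ _ hij.symm, hap, hqa, hpa', haq', haa, haa', hd, single_add]
    simp [single]
    abel
  have hsa {x : A} (hx : star x = x) : IsSelfAdjoint (x * x) := by
    rw [IsSelfAdjoint, star_mul, hx]
  have hdn : ‖d‖ ≤ 1 := by
    have hpq : p * p * (q * q) = 0 := by
      have h0 : p * q = 0 := by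
        rw [hp, hq, mul_assoc, ← mul_assoc (star c), ← star_mul, hc]
        simp
      rw [← mul_assoc, mul_assoc p, h0]
      simp
    rw [hd, (hsa hpsa).norm_add_eq_max (hsa hqsa) hpq]
    exact max_le ((norm_mul_le _ _).trans (mul_le_one₀ hnp (norm_nonneg _) hnp))
      ((norm_mul_le _ _).trans (mul_le_one₀ hnq (norm_nonneg _) hnq))
  refine ⟨X, ?_, ?_⟩
  · rw [← sq_le_one_iff₀ (norm_nonneg _), pow_two, ← CStarRing.norm_star_mul_self, hXstar, hXX]
    have hdsa : IsSelfAdjoint d := (hsa hpsa).add (hsa hqsa)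
    have h1 (k : ι) : IsSelfAdjoint (single k k d) := by
      rw [IsSelfAdjoint, star_single, hdsa.star_eq]
    rw [(h1 i).norm_add_eq_max (h1 j) (single_mul_single_of_ne _ _ hij _ _), norm_single,
      norm_single, max_self]
    exact hdn
  · set α := φ a with hα
    set P := φ p with hP
    set Q := φ q with hQ
    have hPP : star α * α = P * P := by rw [hα, ← hstar, ← hmul, haa', hmul]
    have hαP : α * P = Q * α := by rw [hα, hP, hQ, ← hmul, ← hmul, hpa]
    have hPsa : star P = P := by rw [hP, ← hstar, hpsa]
    have hY : mapₗ φ X = single i i P + single i j (star α) + single j i α + single j j Q := by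
      simp only [X, map_add, mapₗ_single, hstar, hα, hP, hQ]
    -- `Z` is a column on which `φ_n(X)` acts as right multiplication by `2 P`, and this
    -- multiplication scales the norm of `Z` by exactly `2 ‖P‖`.
    let Z : CStarMatrix ι ι B := single i i P + single j i α
    have hYZ : mapₗ φ X * Z = (2 : ℂ) • (Z * single i i P) := by
      rw [hY]
      simp only [Z, mul_add, add_mul, single_mul_single_same, single_mul_single_of_ne _ _ hij,
        single_mul_single_of_ne _ _ hij.symm, hPP, hαP, two_smul]
      abel
    have hZZ : star Z * Z = single i i (P * P) + single i i (P * P) := by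
      simp only [Z, star_add, star_single, mul_add, add_mul, single_mul_single_same,
        single_mul_single_of_ne _ _ hij, single_mul_single_of_ne _ _ hij.symm, hPP, hPsa]
      abel
    have hPn : 1 ≤ ‖P‖ := by
      rw [hP, hp, hmul, hstar, CStarRing.norm_star_mul_self]
      nlinarith
    have hPPn : ‖P * P‖ = ‖P‖ ^ 2 := by
      rw [pow_two, ← CStarRing.norm_star_mul_self, hPsa]
    have hZn : ‖Z‖ ^ 2 = 2 * ‖P‖ ^ 2 := by
      rw [pow_two, ← CStarRing.norm_star_mul_self, hZZ, ← two_smul ℂ, norm_smul, norm_single, hPPn]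
      simp
    have hWn : ‖Z * single i i P‖ ^ 2 = 2 * ‖P‖ ^ 4 := by
      rw [pow_two, ← CStarRing.norm_star_mul_self, star_mul, mul_assoc, ← mul_assoc (star Z), hZZ,
        star_single, hPsa, ← two_smul ℂ, smul_mul_assoc, mul_smul_comm, single_mul_single_same,
        single_mul_single_same, norm_smul, norm_single,
        show P * (P * P * P) = star (P * P) * (P * P) by simp only [star_mul, hPsa, mul_assoc],
        CStarRing.norm_star_mul_self, hPPn, Complex.norm_two]
      ring
    have hW : ‖Z * single i i P‖ = ‖Z‖ * ‖P‖ := by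
      rw [← sq_eq_sq₀ (norm_nonneg _) (by positivity), mul_pow, hWn, hZn]
      ring
    have hZpos : 0 < ‖Z‖ := by
      refine (norm_nonneg Z).lt_of_ne' fun h => ?_
      rw [h] at hZn
      nlinarith
    have h1 : 2 * (‖Z‖ * ‖P‖) ≤ ‖mapₗ φ X‖ * ‖Z‖ := by
      refine le_trans (le_of_eq ?_) (norm_mul_le (mapₗ φ X) Z)
      rw [hYZ, norm_smul, hW, Complex.norm_two]
    nlinarith

end Matrix

/-! ### TRO anti-homomorphisms and ⋆-anti-homomorphisms -/

section AntiHomomorphism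

variable {A B : Type*} [CStarAlgebra A] [CStarAlgebra B] {T : A →ₗ[ℂ] B}

namespace IsTROAntiHom

theorem map_one_mul_star_mul (hT : IsTROAntiHom T) (a : A) : T 1 * star (T 1) * T a = T a := by
  simpa using (hT a 1 1).symm

theorem mul_star_map_one_mul (hT : IsTROAntiHom T) (a : A) : T a * star (T 1) * T 1 = T a := by
  simpa using (hT 1 1 a).symm

/-- The ⋆-anti-homomorphism `a ↦ T(1)⋆ T(a)` attached to a TRO anti-homomorphism `T`, encoded as a
(not necessarily unital) ⋆-homomorphism into the opposite algebra. -/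
noncomputable def starAntiHom (hT : IsTROAntiHom T) : A →⋆ₙₐ[ℂ] Bᵐᵒᵖ where
  toFun a := MulOpposite.op (star (T 1) * T a)
  map_smul' r a := by simp
  map_zero' := by simp
  map_add' a b := by simp [mul_add]
  map_mul' a b := by
    have h : T (a * b) = T b * star (T 1) * T a := by simpa using hT a 1 b
    rw [← MulOpposite.op_mul, h]
    simp only [mul_assoc]
  map_star' a := by
    have h : T (star a) = T 1 * star (T a) * T 1 := by simpa using hT 1 a 1
    rw [← MulOpposite.op_star, h, star_mul, star_star]
    congr 1
    have h' := congrArg star (hT.mul_star_map_one_mul a)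
    simp only [star_mul, star_star, ← mul_assoc] at h' ⊢
    rw [h']

/-- The linear map `a ↦ T(1)⋆ T(a)`; for a TRO anti-homomorphism `T` it is the linear map underlying
`IsTROAntiHom.starAntiHom`. -/
noncomputable def compress (T : A →ₗ[ℂ] B) : A →ₗ[ℂ] B := LinearMap.mulLeft ℂ (star (T 1)) ∘ₗ T

theorem map_one_mul_compress (hT : IsTROAntiHom T) (a : A) : T 1 * compress T a = T a := by
  simpa [compress, mul_assoc] using hT.map_one_mul_star_mul a

theorem compress_mul (hT : IsTROAntiHom T) (a b : A) :
    compress T (a * b) = compress T b * compress T a :=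
  congrArg MulOpposite.unop (map_mul hT.starAntiHom a b)

theorem compress_star (hT : IsTROAntiHom T) (a : A) :
    compress T (star a) = star (compress T a) :=
  congrArg MulOpposite.unop (map_star hT.starAntiHom a)

theorem isTROHom_of_commute (hT : IsTROAntiHom T)
    (h : ∀ a b, Commute (compress T a) (compress T b)) : IsTROHom T := by
  intro a b c
  have h1 : T a * star (T b) * T c =
      T 1 * (compress T a * star (compress T b) * compress T c) := by
    have h2 : star (T b) = star (compress T b) * star (T 1) := by
      rw [← star_mul, hT.map_one_mul_compress]
    rw [h2, ← mul_assoc, ← mul_assoc, ← mul_assoc, hT.map_one_mul_compress,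
      mul_assoc _ (star (T 1)),
      show star (T 1) * T c = compress T c from rfl]
  rw [h1, ← hT.map_one_mul_compress, hT.compress_mul, hT.compress_mul, hT.compress_star,
    ← hT.compress_star, (h (star b) a).eq, ((h c a).mul_right (h c (star b))).eq]

/-- Compression multiplies a matrix by the contraction `1 ⊗ T(1)⋆`. -/
theorem norm_mapₗ_compress_le [PartialOrder B] [StarOrderedRing B] (hT : IsTROAntiHom T)
    {ι : Type*} [Fintype ι] [DecidableEq ι] (X : CStarMatrix ι ι A) :
    ‖CStarMatrix.mapₗ (compress T) X‖ ≤ ‖CStarMatrix.mapₗ T X‖ := by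
  let V : CStarMatrix ι ι B := CStarMatrix.ofMatrix (Matrix.diagonal fun _ => T 1)
  have hV : V * star V * V = V := by
    have hd : (Matrix.diagonal fun _ : ι => T 1) *
        (Matrix.diagonal fun _ : ι => T 1).conjTranspose *
        (Matrix.diagonal fun _ : ι => T 1) = Matrix.diagonal fun _ => T 1 := by
      rw [Matrix.diagonal_conjTranspose, Matrix.diagonal_mul_diagonal,
        Matrix.diagonal_mul_diagonal]
      exact congrArg Matrix.diagonal (funext fun _ => hT.map_one_mul_star_mul 1)
    exact hd
  have hV1 : ‖star V‖ ≤ 1 := by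
    have hp : IsStarProjection (star V * V) :=
      ⟨by rw [IsIdempotentElem, mul_assoc, ← mul_assoc V, hV], .star_mul_self V⟩
    have h := hp.norm_le
    rw [CStarRing.norm_star_mul_self, ← pow_two] at h
    rw [norm_star]
    exact (sq_le_one_iff₀ (norm_nonneg _)).mp h
  have hX : CStarMatrix.mapₗ (compress T) X = star V * CStarMatrix.mapₗ T X := by
    have hd (Y : Matrix ι ι B) :
        (Matrix.diagonal fun _ : ι => T 1).conjTranspose * Y = Y.map (star (T 1) * ·) := by
      ext i j
      rw [Matrix.diagonal_conjTranspose, Matrix.diagonal_mul, Matrix.map_apply]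
      rfl
    exact (hd _).symm
  rw [hX]
  calc _ ≤ ‖star V‖ * ‖CStarMatrix.mapₗ T X‖ := norm_mul_le _ _
    _ ≤ _ := mul_le_of_le_one_left (norm_nonneg _) hV1

end IsTROAntiHom

end AntiHomomorphism

theorem enorm_apply_le_opENorm {E F : Type*} [NormedAddCommGroup E] [NormedSpace ℂ E]
    [NormedAddCommGroup F] [NormedSpace ℂ F] (T : E →ₗ[ℂ] F) {x : E} (hx : ‖x‖ ≤ 1) :
    ‖T x‖ₑ ≤ opENorm T :=
  le_iSup (fun x : {x : E // ‖x‖ ≤ 1} => ‖T x‖ₑ) ⟨x, hx⟩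

/-! ### Copies of full matrix algebras -/

section FiniteDimensional

variable {A B : Type*} [CStarAlgebra A] [CStarAlgebra B] {m : ℕ}

/-- Full matrix algebras are simple. -/
theorem injective_of_apply_ne_zero (π : CStarMatrix (Fin m) (Fin m) ℂ →⋆ₙₐ[ℂ] B)
    {x : CStarMatrix (Fin m) (Fin m) ℂ} (hx : π x ≠ 0) : Function.Injective π := by
  have : Nonempty (Fin m) := by
    by_contra hm
    rw [not_nonempty_iff] at hm
    exact hx (by rw [show x = 0 from funext fun i => hm.elim i, map_zero])
  let f : Matrix (Fin m) (Fin m) ℂ →ₙ+* B := (π : CStarMatrix (Fin m) (Fin m) ℂ →ₙ+* B)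
  rcases eq_bot_or_eq_top (TwoSidedIdeal.ker f) with h | h
  · exact (TwoSidedIdeal.ker_eq_bot f).mp h
  · exact absurd ((TwoSidedIdeal.mem_ker f).mp (h ▸ TwoSidedIdeal.mem_top (x := x))) hx

/-- The ⋆-homomorphism `x ↦ φ(ι(xᵗ))` obtained from a ⋆-homomorphism `ι` on `M_m(ℂ)` and a
⋆-anti-homomorphism `φ`, the latter encoded as a ⋆-homomorphism `ψ` into the opposite algebra. -/
noncomputable def compTranspose (ι : CStarMatrix (Fin m) (Fin m) ℂ →⋆ₙₐ[ℂ] A)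
    (ψ : A →⋆ₙₐ[ℂ] Bᵐᵒᵖ) :
    CStarMatrix (Fin m) (Fin m) ℂ →⋆ₙₐ[ℂ] B where
  toFun x := (ψ (ι (transposeMap m x))).unop
  map_smul' r x := by simp
  map_zero' := by simp
  map_add' x y := by simp
  map_mul' x y := by
    have h : transposeMap m (x * y) = transposeMap m y * transposeMap m x :=
      Matrix.transpose_mul x y
    rw [h, map_mul, map_mul, MulOpposite.unop_mul]
  map_star' x := by
    have h : transposeMap m (star x) = star (transposeMap m x) := rfl
    rw [h, map_star, map_star, MulOpposite.unop_star]

end FiniteDimensional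

/-! ### Lower bounds for the amplifications -/

theorem theorem3p3 {H K : Type*}
    [NormedAddCommGroup H] [InnerProductSpace ℂ H] [CompleteSpace H]
    [NormedAddCommGroup K] [InnerProductSpace ℂ K] [CompleteSpace K]
    (M : VonNeumannAlgebra H) (N : VonNeumannAlgebra K)
    (S : M →ₗ[ℂ] N) (hnormal : IsNormalMap S) (hS : IsTROAntiHom S) :
    ((∃ a b : M, a * b ≠ b * a) → ¬ IsTROHom S →
      ∀ n : ℕ, 2 ≤ n → 2 ≤ opENorm (amplification n S)) ∧
    (∀ (m : ℕ) (ι : CStarMatrix (Fin m) (Fin m) ℂ →⋆ₙₐ[ℂ] M), Function.Injective ι →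
      (∃ x, S (ι x) ≠ 0) →
      ∀ n : ℕ, opENorm (amplification n (transposeMap m)) ≤ opENorm (amplification n S)) := by
  constructor
  · intro _ hhom n hn
    obtain ⟨a, ha, hψa⟩ : ∃ a : M, a * a = 0 ∧ hS.starAntiHom a ≠ 0 := by
      by_contra! h
      refine hhom (hS.isTROHom_of_commute fun a b => ?_)
      exact (MulOpposite.op_injective
        (commute_map_of_map_eq_zero_of_sq hS.starAntiHom h a b).eq).symm
    obtain ⟨c, hc, hc1, hψc⟩ := exists_sq_eq_zero_one_le_norm_map hS.starAntiHom ha hψa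
    obtain ⟨X, hX, hφX⟩ := exists_norm_le_one_two_le_norm_mapₗ (IsTROAntiHom.compress S)
      hS.compress_mul hS.compress_star hc hc1 hψc
      (i := (⟨0, by omega⟩ : Fin n)) (j := ⟨1, by omega⟩) (by simp)
    calc (2 : ℝ≥0∞) = ENNReal.ofReal 2 := by simp
      _ ≤ ENNReal.ofReal ‖amplification n S X‖ :=
        ENNReal.ofReal_le_ofReal (hφX.trans (hS.norm_mapₗ_compress_le X))
      _ = ‖amplification n S X‖ₑ := ofReal_norm _
      _ ≤ _ := enorm_apply_le_opENorm _ hX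
  · intro m ι _ ⟨x, hx⟩ n
    let π := compTranspose ι hS.starAntiHom
    have hπ : Function.Injective π := by
      refine injective_of_apply_ne_zero π (x := transposeMap m x) fun h => hx ?_
      have h' : IsTROAntiHom.compress S (ι x) = 0 := h
      rw [← hS.map_one_mul_compress, h', mul_zero]
    refine iSup_le fun ⟨Y, hY⟩ => ?_
    let X : CStarMatrix (Fin n) (Fin n) M := CStarMatrix.mapₙₐ ι Y
    have hX : ‖X‖ ≤ 1 := (NonUnitalStarAlgHom.norm_apply_le (CStarMatrix.mapₙₐ ι) Y).trans hY
    have hYX : CStarMatrix.mapₙₐ π (amplification n (transposeMap m) Y) =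
        CStarMatrix.mapₗ (IsTROAntiHom.compress S) X := rfl
    have hinj : Function.Injective (CStarMatrix.mapₙₐ (n := Fin n) π) := fun Y₁ Y₂ h => by
      refine CStarMatrix.ext fun i j => hπ (congrFun (congrFun h i) j)
    calc ‖amplification n (transposeMap m) Y‖ₑ
        = ENNReal.ofReal ‖amplification n (transposeMap m) Y‖ := (ofReal_norm _).symm
      _ = ENNReal.ofReal ‖CStarMatrix.mapₗ (IsTROAntiHom.compress S) X‖ := by
        rw [← hYX, NonUnitalStarAlgHom.norm_map _ hinj]
      _ ≤ ENNReal.ofReal ‖amplification n S X‖ :=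
        ENNReal.ofReal_le_ofReal (hS.norm_mapₗ_compress_le X)
      _ = ‖amplification n S X‖ₑ := ofReal_norm _
      _ ≤ _ := enorm_apply_le_opENorm _ hX
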